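/- All commutators are $[g,h]=g^{-1}h^{-1}gh$. For a group $G$, the enhanced power graph $\mathcal{P}_e(G)$ is the simple graph with vertex set $G$ in which distinct $x,y$ are adjacent if and only if $\langle x,y\rangle$ is cyclic. A stem extension of $G$ is a surjective homomorphism $\pi:E\to G$ of groups with $\ker\pi\subseteq Z(E)\cap E'$; a Schur cover of a finite group $G$ is a stem extension $\pi:\tilde G\to G$ with $|\tilde G|$ maximal. The deep commuting graph $\Delta_D(G)$ is the simple graph with vertex set $G$ in which distinct $x,y$ are adjacent if and only if their preimages commute in a Schur cover $\tilde G$ of $G$. Let $p$ be an odd prime, let $k\ge 1$ be an integer, and let $$H_3(\mathbb{Z}/p^k\mathbb{Z})=\langle y_1,y_2,w \mid [y_1,y_2]=w,\ y_1^{p^k}=y_2^{p^k}=w^{p^k}=e=[y_1,w]=[y_2,w]\rangle .$$ (a) Let $\tilde H$ be the group with generators $\tilde y_1,\tilde y_2,\tilde w,w_1,w_2$ and relations $[\tilde y_1,\tilde y_2]=\tilde w$, $[\tilde y_1,\tilde w]=w_1$, $[\tilde y_2,\tilde w]=w_2$, $\tilde y_1^{p^k}=\tilde y_2^{p^k}=\tilde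 w^{p^k}=w_1^{p^k}=w_2^{p^k}=e$, together with the vanishing of the fourth term $\gamma_4$ of the lower central series. Then there is a homomorphism $\pi:\tilde H\to H_3(\mathbb{Z}/p^k\mathbb{Z})$ with $\pi(\tilde y_1)=y_1$, $\pi(\tilde y_2)=y_2$, $\pi(\tilde w)=w$ that is a Schur cover of $H_3(\mathbb{Z}/p^k\mathbb{Z})$, and its kernel (the Schur multiplier) is isomorphic to $C_{p^k}\times C_{p^k}$. The group $\tilde H$ has nilpotency class exactly $3$. (b) Whichever Schur cover of $H_3(\mathbb{Z}/p^k\mathbb{Z})$ is used to define $\Delta_D$, $$\mathcal{P}_e(H_3(\mathbb{Z}/p^k\mathbb{Z}))=\Delta_D(H_3(\mathbb{Z}/p^k\mathbb{Z}))\quad\text{if and only if}\quad k=1 .$$ -/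

import Mathlib

namespace DeepCommuting

universe u v

/-- The commutator in the convention `[g, h] = g⁻¹ h⁻¹ g h`. -/
def comm {G : Type u} [Group G] (g h : G) : G := g⁻¹ * h⁻¹ * g * h

/-- The enhanced power graph: distinct `x`, `y` are adjacent iff `⟨x, y⟩` is cyclic. -/
def enhancedPowerGraph (G : Type u) [Group G] : SimpleGraph G where
  Adj x y := x ≠ y ∧ IsCyclic (Subgroup.closure ({x, y} : Set G))
  symm := ⟨fun x y h => ⟨h.1.symm, by rw [Set.pair_comm y x]; exact h.2⟩⟩
  loopless := ⟨fun _ h => h.1 rfl⟩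

/-- `π : E → G` is a stem extension of `G`: it is onto and its kernel lies in `Z(E) ∩ E'`. -/
structure IsStemExtension {E : Type v} {G : Type u} [Group E] [Group G] (π : E →* G) : Prop where
  surjective : Function.Surjective π
  ker_le_center : π.ker ≤ Subgroup.center E
  ker_le_commutator : π.ker ≤ commutator E

/-- `π : E → G` is a Schur cover of the finite group `G`: a stem extension of maximal order.
All stem extensions of a finite group are finite, so it is enough to compare with
those living in the universe of `G`. -/
structure IsSchurCover {E : Type v} {G : Type u} [Group E] [Group G] (π : E →* G) : Prop where
  stem : IsStemExtension π
  card_le : ∀ (F : Type u) [Group F] (ρ : F →* G), IsStemExtension ρ → Nat.card F ≤ Nat.card E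

/-- The deep commuting graph of `G`, computed in the Schur cover `π : E → G`: distinct `x`, `y`
are adjacent iff their preimages commute in `E`. -/
def deepCommutingGraph {E : Type v} {G : Type u} [Group E] [Group G] (π : E →* G) :
    SimpleGraph G where
  Adj x y := x ≠ y ∧ ∀ a b : E, π a = x → π b = y → Commute a b
  symm := ⟨fun _ _ h => ⟨h.1.symm, fun a b ha hb => (h.2 b a hb ha).symm⟩⟩
  loopless := ⟨fun _ h => h.1 rfl⟩

/-- The generators of the Heisenberg group. -/
inductive HGen : Type
  | y₁ | y₂ | w

open FreeGroup in
/-- The relations `[y₁, y₂] = w`, `y₁ⁿ = y₂ⁿ = wⁿ = e`, `[y₁, w] = [y₂, w] = e`. -/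
def heisenbergRels (n : ℕ) : Set (FreeGroup HGen) :=
  {comm (of .y₁) (of .y₂) * (of .w)⁻¹,
   of .y₁ ^ n, of .y₂ ^ n, of .w ^ n,
   comm (of .y₁) (of .w), comm (of .y₂) (of .w)}

/-- The Heisenberg group `H₃(ℤ/nℤ)`, by its presentation. -/
abbrev Heisenberg (n : ℕ) : Type := PresentedGroup (heisenbergRels n)

/-- The generators of the covering group of the Heisenberg group. -/
inductive CGen : Type
  | y₁ | y₂ | w | w₁ | w₂

open FreeGroup in
/-- The relations `[y₁, y₂] = w`, `[y₁, w] = w₁`, `[y₂, w] = w₂`, all five generators have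
`n`-th power `e`, and the group is nilpotent of class at most `3`: the last set is the fourth term
`γ₄` of the lower central series of the free group (Mathlib numbers the series from `0`). -/
def heisenbergCoverRels (n : ℕ) : Set (FreeGroup CGen) :=
  {comm (of .y₁) (of .y₂) * (of .w)⁻¹,
   comm (of .y₁) (of .w) * (of .w₁)⁻¹, comm (of .y₂) (of .w) * (of .w₂)⁻¹,
   of .y₁ ^ n, of .y₂ ^ n, of .w ^ n, of .w₁ ^ n, of .w₂ ^ n}
  ∪ ((⊤ : Subgroup (FreeGroup CGen)).lowerCentralSeries 3 : Set (FreeGroup CGen))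

/-- The covering group of `H₃(ℤ/nℤ)`, by its presentation as a group of class `3`. -/
abbrev HeisenbergCover (n : ℕ) : Type := PresentedGroup (heisenbergCoverRels n)

end DeepCommuting

open DeepCommuting

/-! Write n = p^k and H for the Heisenberg group. In a stem extension of H, lift y₁, y₂ to a, b and
put c = [a, b]. The elements [a, c], [b, c] lie in the central kernel, have n-th power 1, and
generate it (`IsStemExtension.ker_eq_closure`), so the kernel has order at most n². The covering
group attains this bound: its kernel is ⟨w₁, w₂⟩, and w₁, w₂ are independent of order n because they
land in different coordinates of an explicit class-3 group over ℤ/n, where 2 is invertible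
(`HeisenbergCover.w₁_zpow_mul_w₂_zpow_eq_one`). Hence a stem extension is a Schur cover exactly when
its kernel has order n², and then [a, c], [b, c] are independent.

The graphs are compared by one formula (`IsStemExtension.comm_eq`): if e lies over y₁^i y₂^j w^l,
then [e, c^s] = [a, c]^(is) [b, c]^(js). Elements of a common cyclic subgroup always have commuting
lifts, so only the reverse inclusion matters. For k = 1, commuting lifts with x noncentral give y =
x^t w^s by linear algebra over a field, and the formula forces s = 0. For k ≥ 2 zero divisors break
this: y₁^(p^(k-1)) and w^p have commuting lifts, yet no cyclic subgroup contains both, since it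
would have two subgroups of order p. -/

namespace DeepCommuting

/-! ### Commutator identities and generation -/

section Commutators

variable {G H : Type*} [Group G] [Group H]

theorem map_comm (f : G →* H) (g h : G) : f (comm g h) = comm (f g) (f h) := by
  simp [comm]

theorem comm_eq_one_iff {g h : G} : comm g h = 1 ↔ Commute g h := by
  rw [comm, mul_assoc, ← mul_inv_rev, inv_mul_eq_one]
  exact eq_comm

open scoped commutatorElement in
theorem comm_eq_commutatorElement (g h : G) : comm g h = ⁅g⁻¹, h⁻¹⁆ := by
  simp [comm, commutatorElement_def]

theorem comm_inv (g h : G) : (comm g h)⁻¹ = comm h g := by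
  simp [comm, mul_assoc]

theorem mul_comm_eq (g h : G) : g * h = h * g * comm g h := by
  simp [comm, mul_assoc]

theorem comm_eq_iff {g h z : G} : comm g h = z ↔ g * h = h * g * z := by
  rw [mul_comm_eq g h, mul_left_cancel_iff]

theorem comm_mul_left {g g' h : G} (hc : comm g h ∈ Subgroup.center G) :
    comm (g * g') h = comm g h * comm g' h := by
  have h1 := Subgroup.mem_center_iff.1 hc g'
  calc comm (g * g') h = g'⁻¹ * (comm g h * (h⁻¹ * g' * h)) := by simp [comm, mul_assoc]
    _ = comm g h * comm g' h := by
      have h2 : g'⁻¹ * comm g h = comm g h * g'⁻¹ := by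
        rw [inv_mul_eq_iff_eq_mul, ← mul_assoc, h1, mul_inv_cancel_right]
      rw [← mul_assoc, h2]
      simp [comm, mul_assoc]

/-- Conjugation by h sends g to g[g, h], a product of commuting factors, so its i-th power splits.
-/
theorem comm_zpow_left {g h : G} (hc : comm g h ∈ Subgroup.center G) (i : ℤ) :
    comm (g ^ i) h = comm g h ^ i := by
  have h1 : h⁻¹ * g * h = g * comm g h := by simp [comm, mul_assoc]
  have h2 : h⁻¹ * g ^ i * h = (h⁻¹ * g * h) ^ i := by
    simpa using (conj_zpow (a := h⁻¹) (b := g) (i := i)).symm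
  have h3 : Commute g (comm g h) := Subgroup.mem_center_iff.1 hc g
  have h4 : comm (g ^ i) h = (g ^ i)⁻¹ * (h⁻¹ * g ^ i * h) := by simp [comm, mul_assoc]
  rw [h4, h2, h1, h3.mul_zpow, inv_mul_cancel_left]

theorem comm_zpow_right {g h : G} (hc : comm g h ∈ Subgroup.center G) (i : ℤ) :
    comm g (h ^ i) = comm g h ^ i := by
  rw [← comm_inv, comm_zpow_left, ← inv_zpow, comm_inv]
  rw [← comm_inv]
  exact inv_mem hc

theorem normal_of_le_center {N : Subgroup G} (hN : N ≤ Subgroup.center G) : N.Normal :=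
  ⟨fun x hx g => by rwa [Subgroup.mem_center_iff.1 (hN hx) g, mul_inv_cancel_right]⟩

/-- If the generators of `G` commute modulo a normal subgroup, then it contains the commutator
subgroup. -/
theorem commutator_le_of_closure_eq_top {S : Set G} (hS : Subgroup.closure S = ⊤)
    {D : Subgroup G} [D.Normal] (h : ∀ s ∈ S, ∀ t ∈ S, comm s t ∈ D) : commutator G ≤ D := by
  have key : ∀ g h : G, comm g h ∈ D ↔ Commute (g : G ⧸ D) (h : G ⧸ D) := fun g h => by
    rw [← comm_eq_one_iff, ← QuotientGroup.eq_one_iff]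
    rfl
  -- Centralizers are subgroups, so commuting modulo D spreads from generators to the whole group,
  -- one argument at a time.
  have h1 : ∀ s ∈ S, ∀ g : G, Commute (s : G ⧸ D) (g : G ⧸ D) := by
    intro s hs g
    have : Subgroup.closure S ≤
        (Subgroup.centralizer {(s : G ⧸ D)}).comap (QuotientGroup.mk' D) := by
      rw [Subgroup.closure_le]
      intro t ht
      have := (key s t).1 (h s hs t ht)
      simpa [Subgroup.mem_centralizer_singleton_iff] using this.eq.symm
    rw [hS] at this
    have := this (Subgroup.mem_top g)
    simp only [Subgroup.mem_comap, Subgroup.mem_centralizer_singleton_iff] at this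
    exact this.symm
  have h2 : ∀ g g' : G, Commute (g : G ⧸ D) (g' : G ⧸ D) := by
    intro g g'
    have : Subgroup.closure S ≤
        (Subgroup.centralizer {(g' : G ⧸ D)}).comap (QuotientGroup.mk' D) := by
      rw [Subgroup.closure_le]
      intro t ht
      simpa [Subgroup.mem_centralizer_singleton_iff] using (h1 t ht g').eq
    rw [hS] at this
    have := this (Subgroup.mem_top g)
    simp only [Subgroup.mem_comap, Subgroup.mem_centralizer_singleton_iff] at this
    exact this
  rw [commutator_def, Subgroup.commutator_le]
  intro g _ g' _
  have := (key g⁻¹ g'⁻¹).2 (h2 _ _)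
  simpa [comm, commutatorElement_def] using this

theorem closure_lifts_union_ker (f : G →* H) {S : Set G} (hS : Subgroup.closure (f '' S) = ⊤) :
    Subgroup.closure (S ∪ f.ker) = ⊤ := by
  rw [Subgroup.closure_union, Subgroup.closure_eq, ← Subgroup.comap_map_eq, MonoidHom.map_closure,
    hS, Subgroup.comap_top]

theorem comm_mem_lowerCentralSeries {i : ℕ} {g h : G}
    (hh : h ∈ (⊤ : Subgroup G).lowerCentralSeries i) :
    comm g h ∈ (⊤ : Subgroup G).lowerCentralSeries (i + 1) := by
  rw [← comm_inv, Subgroup.lowerCentralSeries_succ, comm_eq_commutatorElement]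
  exact inv_mem (Subgroup.commutator_mem_commutator (inv_mem hh) (Subgroup.mem_top _))

end Commutators

/-! ### Homomorphisms out of ℤ/n × ℤ/n -/

section PairHom

variable {G : Type*} [Group G] {n : ℕ}

/-- The homomorphism from `ℤ/n` sending the generator to an element whose `n`-th power is `1`. -/
def zmodPowHom (u : G) (hu : u ^ n = 1) : Multiplicative (ZMod n) →* G :=
  AddMonoidHom.toMultiplicativeLeft (ZMod.lift n
    ⟨zmultiplesHom (Additive G) (Additive.ofMul u), by
      rw [zmultiplesHom_apply, natCast_zsmul, ← ofMul_pow, hu, ofMul_one]⟩)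

theorem zmodPowHom_intCast (u : G) (hu : u ^ n = 1) (i : ℤ) :
    zmodPowHom u hu (Multiplicative.ofAdd (i : ZMod n)) = u ^ i := by
  change Additive.toMul (ZMod.lift n _ (i : ZMod n)) = u ^ i
  rw [ZMod.lift_coe]
  rfl

/-- The homomorphism from `ℤ/n × ℤ/n` given by two commuting elements whose `n`-th powers
are `1`. -/
def zmodPairHom (u v : G) (hu : u ^ n = 1) (hv : v ^ n = 1) (huv : Commute u v) :
    Multiplicative (ZMod n) × Multiplicative (ZMod n) →* G :=
  (zmodPowHom u hu).noncommCoprod (zmodPowHom v hv) (fun x y => by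
    obtain ⟨i, hi⟩ := ZMod.intCast_surjective x.toAdd
    obtain ⟨j, hj⟩ := ZMod.intCast_surjective y.toAdd
    rw [← ofAdd_toAdd x, ← ofAdd_toAdd y, ← hi, ← hj, zmodPowHom_intCast, zmodPowHom_intCast]
    exact huv.zpow_zpow i j)

variable {u v : G} (hu : u ^ n = 1) (hv : v ^ n = 1) (huv : Commute u v)

theorem zmodPairHom_intCast (i j : ℤ) :
    zmodPairHom u v hu hv huv
      (Multiplicative.ofAdd (i : ZMod n), Multiplicative.ofAdd (j : ZMod n)) = u ^ i * v ^ j := by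
  simp [zmodPairHom, zmodPowHom_intCast]

theorem range_zmodPairHom :
    (zmodPairHom u v hu hv huv).range = Subgroup.closure {u, v} := by
  apply le_antisymm
  · rintro _ ⟨⟨x, y⟩, rfl⟩
    obtain ⟨i, hi⟩ := ZMod.intCast_surjective x.toAdd
    obtain ⟨j, hj⟩ := ZMod.intCast_surjective y.toAdd
    have := zmodPairHom_intCast hu hv huv i j
    rw [hi, hj, ofAdd_toAdd, ofAdd_toAdd] at this
    rw [this]
    exact mul_mem (zpow_mem (Subgroup.subset_closure (by simp)) _)
      (zpow_mem (Subgroup.subset_closure (by simp)) _)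
  · rw [Subgroup.closure_le]
    rintro x (rfl | rfl)
    · exact ⟨_, (zmodPairHom_intCast hu hv huv 1 0).trans (by simp)⟩
    · exact ⟨_, (zmodPairHom_intCast hu hv huv 0 1).trans (by simp)⟩

theorem card_zmod_pair (n : ℕ) :
    Nat.card (Multiplicative (ZMod n) × Multiplicative (ZMod n)) = n ^ 2 := by
  rw [Nat.card_prod, Nat.card_congr Multiplicative.toAdd, Nat.card_zmod, sq]

end PairHom

/-! ### Coordinate models of class 2 and class 3 -/

/-- Upper unitriangular `3 × 3` matrices over `R`, in coordinates. -/
@[ext]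
structure HeisenbergModel (R : Type*) where
  /-- The exponent of the first generator. -/
  a : R
  /-- The exponent of the second generator. -/
  b : R
  /-- The central coordinate. -/
  c : R

namespace HeisenbergModel

variable {R : Type*} [CommRing R]

instance : Mul (HeisenbergModel R) := ⟨fun x y => ⟨x.a + y.a, x.b + y.b, x.c + y.c + x.a * y.b⟩⟩

instance : One (HeisenbergModel R) := ⟨⟨0, 0, 0⟩⟩

instance : Inv (HeisenbergModel R) := ⟨fun x => ⟨-x.a, -x.b, x.a * x.b - x.c⟩⟩

@[simp] theorem mul_a (x y : HeisenbergModel R) : (x * y).a = x.a + y.a := rfl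
@[simp] theorem mul_b (x y : HeisenbergModel R) : (x * y).b = x.b + y.b := rfl
@[simp] theorem mul_c (x y : HeisenbergModel R) : (x * y).c = x.c + y.c + x.a * y.b := rfl
@[simp] theorem one_a : (1 : HeisenbergModel R).a = 0 := rfl
@[simp] theorem one_b : (1 : HeisenbergModel R).b = 0 := rfl
@[simp] theorem one_c : (1 : HeisenbergModel R).c = 0 := rfl
@[simp] theorem inv_a (x : HeisenbergModel R) : x⁻¹.a = -x.a := rfl
@[simp] theorem inv_b (x : HeisenbergModel R) : x⁻¹.b = -x.b := rfl
@[simp] theorem inv_c (x : HeisenbergModel R) : x⁻¹.c = x.a * x.b - x.c := rfl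

instance : Group (HeisenbergModel R) :=
  Group.ofLeftAxioms
    (fun x y z => by ext <;> simp <;> ring)
    (fun x => by ext <;> simp)
    (fun x => by ext <;> simp)

/-- The first coordinate, as a homomorphism. -/
def aHom : HeisenbergModel R →* Multiplicative R where
  toFun x := .ofAdd x.a
  map_one' := rfl
  map_mul' _ _ := rfl

/-- The second coordinate, as a homomorphism. -/
def bHom : HeisenbergModel R →* Multiplicative R where
  toFun x := .ofAdd x.b
  map_one' := rfl
  map_mul' _ _ := rfl

theorem zpow_a (x : HeisenbergModel R) (i : ℤ) : (x ^ i).a = i * x.a := by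
  have := congrArg Multiplicative.toAdd (map_zpow aHom x i)
  simpa [aHom] using this

theorem zpow_b (x : HeisenbergModel R) (i : ℤ) : (x ^ i).b = i * x.b := by
  have := congrArg Multiplicative.toAdd (map_zpow bHom x i)
  simpa [bHom] using this

/-- The one-parameter subgroups on which the group law is additive. -/
theorem mk_pow (a b c : R) (h : a * b = 0) (m : ℕ) :
    (⟨a, b, c⟩ : HeisenbergModel R) ^ m = ⟨m * a, m * b, m * c⟩ := by
  induction m with
  | zero => ext <;> simp
  | succ m ih =>
    rw [pow_succ, ih]
    ext <;> simp [mul_assoc, h] <;> ring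

theorem mk_zpow (a b c : R) (h : a * b = 0) (i : ℤ) :
    (⟨a, b, c⟩ : HeisenbergModel R) ^ i = ⟨i * a, i * b, i * c⟩ := by
  obtain ⟨m, rfl | rfl⟩ := i.eq_nat_or_neg
  · simpa using mk_pow a b c h m
  · rw [zpow_neg, zpow_natCast, mk_pow a b c h]
    ext <;> simp
    linear_combination (m : R) * m * h

theorem comm_y₁_y₂ : comm (⟨1, 0, 0⟩ : HeisenbergModel R) ⟨0, 1, 0⟩ = ⟨0, 0, 1⟩ := by
  rw [comm_eq_iff]; ext <;> simp

theorem comm_y₁_w : comm (⟨1, 0, 0⟩ : HeisenbergModel R) ⟨0, 0, 1⟩ = 1 := by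
  rw [comm_eq_iff]; ext <;> simp

theorem comm_y₂_w : comm (⟨0, 1, 0⟩ : HeisenbergModel R) ⟨0, 0, 1⟩ = 1 := by
  rw [comm_eq_iff]; ext <;> simp

instance [Finite R] : Finite (HeisenbergModel R) :=
  Finite.of_injective (fun x => (x.a, x.b, x.c)) fun x y h => by
    simp only [Prod.mk.injEq] at h
    exact HeisenbergModel.ext h.1 h.2.1 h.2.2

end HeisenbergModel

/-- The free nilpotent group of class `3` on two generators over a ring in which `2` is
invertible, in coordinates. -/
@[ext]
structure CoverModel (R : Type*) where
  /-- The exponent of the first generator. -/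
  a : R
  /-- The exponent of the second generator. -/
  b : R
  /-- The coordinate of weight two. -/
  c : R
  /-- The first coordinate of weight three. -/
  u : R
  /-- The second coordinate of weight three. -/
  v : R

namespace CoverModel

variable {R : Type*} [CommRing R]

instance : One (CoverModel R) := ⟨⟨0, 0, 0, 0, 0⟩⟩

@[simp] theorem one_a : (1 : CoverModel R).a = 0 := rfl
@[simp] theorem one_b : (1 : CoverModel R).b = 0 := rfl
@[simp] theorem one_c : (1 : CoverModel R).c = 0 := rfl
@[simp] theorem one_u : (1 : CoverModel R).u = 0 := rfl
@[simp] theorem one_v : (1 : CoverModel R).v = 0 := rfl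

variable [Invertible (2 : R)]

/-- The coordinates a, b, c, u multiply as the unitriangular 4 × 4 matrices with rows (1, a, a²/2,
u), (0, 1, a, c), (0, 0, 1, b), (0, 0, 0, 1). The coordinate v is the same construction with a and b
exchanged, which replaces c by ab - c. -/
instance : Mul (CoverModel R) :=
  ⟨fun x y => ⟨x.a + y.a, x.b + y.b, x.c + y.c + x.a * y.b,
    x.u + y.u + x.a * y.c + ⅟2 * x.a ^ 2 * y.b,
    x.v + y.v + x.b * (y.a * y.b - y.c) + ⅟2 * x.b ^ 2 * y.a⟩⟩

instance : Inv (CoverModel R) :=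
  ⟨fun x => ⟨-x.a, -x.b, x.a * x.b - x.c, -x.u + x.a * x.c - ⅟2 * x.a ^ 2 * x.b,
    -x.v + x.b * (x.a * x.b - x.c) - ⅟2 * x.b ^ 2 * x.a⟩⟩

@[simp] theorem mul_a (x y : CoverModel R) : (x * y).a = x.a + y.a := rfl
@[simp] theorem mul_b (x y : CoverModel R) : (x * y).b = x.b + y.b := rfl
@[simp] theorem mul_c (x y : CoverModel R) : (x * y).c = x.c + y.c + x.a * y.b := rfl
@[simp] theorem mul_u (x y : CoverModel R) :
    (x * y).u = x.u + y.u + x.a * y.c + ⅟2 * x.a ^ 2 * y.b := rfl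
@[simp] theorem mul_v (x y : CoverModel R) :
    (x * y).v = x.v + y.v + x.b * (y.a * y.b - y.c) + ⅟2 * x.b ^ 2 * y.a := rfl
@[simp] theorem inv_a (x : CoverModel R) : x⁻¹.a = -x.a := rfl
@[simp] theorem inv_b (x : CoverModel R) : x⁻¹.b = -x.b := rfl
@[simp] theorem inv_c (x : CoverModel R) : x⁻¹.c = x.a * x.b - x.c := rfl
@[simp] theorem inv_u (x : CoverModel R) :
    x⁻¹.u = -x.u + x.a * x.c - ⅟2 * x.a ^ 2 * x.b := rfl
@[simp] theorem inv_v (x : CoverModel R) :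
    x⁻¹.v = -x.v + x.b * (x.a * x.b - x.c) - ⅟2 * x.b ^ 2 * x.a := rfl

instance : Group (CoverModel R) :=
  Group.ofLeftAxioms
    (fun x y z => by
      have h : (2 : R) * ⅟2 = 1 := mul_invOf_self 2
      ext
      · simp; ring
      · simp; ring
      · simp; ring
      · simp only [mul_a, mul_b, mul_c, mul_u]
        linear_combination (x.a * y.a * z.b) * h
      · simp only [mul_a, mul_b, mul_c, mul_v]
        linear_combination (x.b * y.b * z.a) * h)
    (fun x => by ext <;> simp)
    (fun x => by ext <;> simp <;> ring)

theorem y₁_pow (m : ℕ) : (⟨1, 0, 0, 0, 0⟩ : CoverModel R) ^ m = ⟨m, 0, 0, 0, 0⟩ := by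
  induction m with
  | zero => ext <;> simp
  | succ m ih => rw [pow_succ, ih]; ext <;> simp

theorem y₂_pow (m : ℕ) : (⟨0, 1, 0, 0, 0⟩ : CoverModel R) ^ m = ⟨0, m, 0, 0, 0⟩ := by
  induction m with
  | zero => ext <;> simp
  | succ m ih => rw [pow_succ, ih]; ext <;> simp

theorem mk_pow (c u v : R) (m : ℕ) :
    (⟨0, 0, c, u, v⟩ : CoverModel R) ^ m = ⟨0, 0, m * c, m * u, m * v⟩ := by
  induction m with
  | zero => ext <;> simp
  | succ m ih => rw [pow_succ, ih]; ext <;> simp <;> ring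

theorem mk_zpow (c u v : R) (i : ℤ) :
    (⟨0, 0, c, u, v⟩ : CoverModel R) ^ i = ⟨0, 0, i * c, i * u, i * v⟩ := by
  obtain ⟨m, rfl | rfl⟩ := i.eq_nat_or_neg
  · simpa using mk_pow c u v m
  · rw [zpow_neg, zpow_natCast, mk_pow]
    ext <;> simp

/-- The weight-three entries ∓1/2 are central, so they do not affect later commutators with this
element. -/
theorem comm_y₁_y₂ : comm (⟨1, 0, 0, 0, 0⟩ : CoverModel R) ⟨0, 1, 0, 0, 0⟩ =
    ⟨0, 0, 1, -⅟2, ⅟2⟩ := by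
  have h : (2 : R) * ⅟2 = 1 := mul_invOf_self 2
  rw [comm_eq_iff]
  ext <;> simp
  linear_combination h

theorem comm_y₁_w : comm (⟨1, 0, 0, 0, 0⟩ : CoverModel R) ⟨0, 0, 1, -⅟2, ⅟2⟩ =
    ⟨0, 0, 0, 1, 0⟩ := by
  rw [comm_eq_iff]; ext <;> simp

theorem comm_y₂_w : comm (⟨0, 1, 0, 0, 0⟩ : CoverModel R) ⟨0, 0, 1, -⅟2, ⅟2⟩ =
    ⟨0, 0, 0, 0, -1⟩ := by
  rw [comm_eq_iff]; ext <;> simp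

/-- The elements of weight at least two. -/
def weightTwo (R : Type*) [CommRing R] [Invertible (2 : R)] : Subgroup (CoverModel R) where
  carrier := {x | x.a = 0 ∧ x.b = 0}
  one_mem' := ⟨rfl, rfl⟩
  mul_mem' := fun hx hy => ⟨by simp [hx.1, hy.1], by simp [hx.2, hy.2]⟩
  inv_mem' := fun hx => ⟨by simp [hx.1], by simp [hx.2]⟩

/-- The elements of weight at least three. -/
def weightThree (R : Type*) [CommRing R] [Invertible (2 : R)] : Subgroup (CoverModel R) where
  carrier := {x | x.a = 0 ∧ x.b = 0 ∧ x.c = 0}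
  one_mem' := ⟨rfl, rfl, rfl⟩
  mul_mem' := fun hx hy => ⟨by simp [hx.1, hy.1], by simp [hx.2.1, hy.2.1],
    by simp [hx.1, hx.2.2, hy.2.2]⟩
  inv_mem' := fun hx => ⟨by simp [hx.1], by simp [hx.2.1], by simp [hx.1, hx.2.2]⟩

open scoped commutatorElement in
theorem lowerCentralSeries_three : (⊤ : Subgroup (CoverModel R)).lowerCentralSeries 3 = ⊥ := by
  have h1 : (⊤ : Subgroup (CoverModel R)).lowerCentralSeries 1 ≤ weightTwo R := by
    rw [Subgroup.lowerCentralSeries_succ, Subgroup.commutator_le]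
    intro x _ y _
    exact ⟨by simp [commutatorElement_def], by simp [commutatorElement_def]⟩
  have h2 : (⊤ : Subgroup (CoverModel R)).lowerCentralSeries 2 ≤ weightThree R := by
    rw [Subgroup.lowerCentralSeries_succ, Subgroup.commutator_le]
    intro x hx y _
    obtain ⟨hx1, hx2⟩ := h1 hx
    refine ⟨by simp [commutatorElement_def], by simp [commutatorElement_def], ?_⟩
    simp only [commutatorElement_def, mul_a, mul_c, inv_a, inv_b, inv_c, hx1, hx2]
    ring
  rw [Subgroup.lowerCentralSeries_succ, eq_bot_iff, Subgroup.commutator_le]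
  intro x hx y _
  obtain ⟨hx1, hx2, hx3⟩ := h2 hx
  rw [Subgroup.mem_bot, commutatorElement_eq_one_iff_mul_comm]
  ext <;> simp [hx1, hx2, hx3] <;> ring

end CoverModel

/-! ### The Heisenberg group from its presentation -/

namespace Heisenberg

variable {n : ℕ}

/-- The first generator of the Heisenberg group. -/
def y₁ : Heisenberg n := PresentedGroup.of .y₁

/-- The second generator of the Heisenberg group. -/
def y₂ : Heisenberg n := PresentedGroup.of .y₂

/-- The central generator of the Heisenberg group. -/
def w : Heisenberg n := PresentedGroup.of .w

theorem mk_eq_one {r : FreeGroup HGen} (hr : r ∈ heisenbergRels n) :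
    PresentedGroup.mk (heisenbergRels n) r = 1 :=
  (QuotientGroup.eq_one_iff r).2 (Subgroup.subset_normalClosure hr)

theorem comm_y₁_y₂ : comm (y₁ : Heisenberg n) y₂ = w := by
  have := mk_eq_one (n := n) (r := _ * _) (.inl rfl)
  rw [map_mul, map_inv, map_comm, mul_inv_eq_one] at this
  exact this

theorem y₁_pow : (y₁ : Heisenberg n) ^ n = 1 := by
  have := mk_eq_one (n := n) (r := FreeGroup.of .y₁ ^ n) (by simp [heisenbergRels])
  rwa [map_pow] at this

theorem y₂_pow : (y₂ : Heisenberg n) ^ n = 1 := by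
  have := mk_eq_one (n := n) (r := FreeGroup.of .y₂ ^ n) (by simp [heisenbergRels])
  rwa [map_pow] at this

theorem w_pow : (w : Heisenberg n) ^ n = 1 := by
  have := mk_eq_one (n := n) (r := FreeGroup.of .w ^ n) (by simp [heisenbergRels])
  rwa [map_pow] at this

theorem commute_y₁_w : Commute (y₁ : Heisenberg n) w := by
  have := mk_eq_one (n := n) (r := comm (.of .y₁) (.of .w)) (by simp [heisenbergRels])
  rwa [map_comm, comm_eq_one_iff] at this

theorem commute_y₂_w : Commute (y₂ : Heisenberg n) w := by
  have := mk_eq_one (n := n) (r := comm (.of .y₂) (.of .w)) (by simp [heisenbergRels])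
  rwa [map_comm, comm_eq_one_iff] at this

/-- The universal property of the Heisenberg group. -/
theorem exists_lift {G : Type*} [Group G] (a b c : G) (hc : comm a b = c) (ha : a ^ n = 1)
    (hb : b ^ n = 1) (hcn : c ^ n = 1) (hac : Commute a c) (hbc : Commute b c) :
    ∃ f : Heisenberg n →* G, f y₁ = a ∧ f y₂ = b ∧ f w = c := by
  let g : HGen → G := fun
    | .y₁ => a
    | .y₂ => b
    | .w => c
  have hg : ∀ r ∈ heisenbergRels n, FreeGroup.lift g r = 1 := by
    rintro r (rfl | rfl | rfl | rfl | rfl | rfl)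
    · simp [map_comm, g, hc]
    · simp [g, ha]
    · simp [g, hb]
    · simp [g, hcn]
    · simpa [map_comm, g, comm_eq_one_iff] using hac
    · simpa [map_comm, g, comm_eq_one_iff] using hbc
  exact ⟨PresentedGroup.toGroup hg, PresentedGroup.toGroup.of hg, PresentedGroup.toGroup.of hg,
    PresentedGroup.toGroup.of hg⟩

theorem closure_y₁_y₂ : Subgroup.closure {(y₁ : Heisenberg n), y₂} = ⊤ := by
  rw [eq_top_iff, ← PresentedGroup.closure_range_of, Subgroup.closure_le]
  have h1 : (y₁ : Heisenberg n) ∈ Subgroup.closure {(y₁ : Heisenberg n), y₂} :=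
    Subgroup.subset_closure (by simp)
  have h2 : (y₂ : Heisenberg n) ∈ Subgroup.closure {(y₁ : Heisenberg n), y₂} :=
    Subgroup.subset_closure (by simp)
  rintro _ ⟨(_ | _ | _), rfl⟩
  · exact h1
  · exact h2
  · change (w : Heisenberg n) ∈ _
    rw [← comm_y₁_y₂]
    exact mul_mem (mul_mem (mul_mem (inv_mem h1) (inv_mem h2)) h1) h2

theorem w_mem_center : (w : Heisenberg n) ∈ Subgroup.center (Heisenberg n) := by
  have : Subgroup.closure {(y₁ : Heisenberg n), y₂} ≤ Subgroup.centralizer {w} := by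
    rw [Subgroup.closure_le]
    rintro _ (rfl | rfl)
    · exact Subgroup.mem_centralizer_singleton_iff.2 commute_y₁_w
    · exact Subgroup.mem_centralizer_singleton_iff.2 commute_y₂_w
  rw [closure_y₁_y₂] at this
  exact Subgroup.mem_center_iff.2 fun g =>
    Subgroup.mem_centralizer_singleton_iff.1 (this (Subgroup.mem_top g))

theorem commutator_le_zpowers_w : commutator (Heisenberg n) ≤ Subgroup.zpowers w := by
  have : (Subgroup.zpowers (w : Heisenberg n)).Normal :=
    normal_of_le_center (Subgroup.zpowers_le.2 w_mem_center)
  refine commutator_le_of_closure_eq_top closure_y₁_y₂ ?_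
  have hw := Subgroup.mem_zpowers (w : Heisenberg n)
  rintro _ (rfl | rfl) _ (rfl | rfl)
  · rw [comm_eq_one_iff.2 (Commute.refl _)]; exact one_mem _
  · rwa [comm_y₁_y₂]
  · rw [← comm_inv, comm_y₁_y₂]; exact inv_mem hw
  · rw [comm_eq_one_iff.2 (Commute.refl _)]; exact one_mem _

theorem lowerCentralSeries_two : (⊤ : Subgroup (Heisenberg n)).lowerCentralSeries 2 = ⊥ := by
  rw [Subgroup.lowerCentralSeries_succ, Subgroup.top_lowerCentralSeries_one,
    Subgroup.commutator_eq_bot_iff_le_centralizer]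
  refine commutator_le_zpowers_w.trans ?_
  rw [Subgroup.coe_top, Subgroup.centralizer_univ, Subgroup.zpowers_le]
  exact w_mem_center

theorem y₂_zpow_mul_y₁_zpow (j i : ℤ) :
    (y₂ : Heisenberg n) ^ j * y₁ ^ i = y₁ ^ i * y₂ ^ j * w ^ (-(j * i)) := by
  have h1 : comm (y₂ : Heisenberg n) y₁ = w⁻¹ := by rw [← comm_inv, comm_y₁_y₂]
  have h2 : comm (y₂ : Heisenberg n) y₁ ∈ Subgroup.center _ := by
    rw [h1]; exact inv_mem w_mem_center
  have h3 : comm (y₂ ^ j : Heisenberg n) y₁ ∈ Subgroup.center _ := by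
    rw [comm_zpow_left h2]; exact zpow_mem h2 j
  rw [mul_comm_eq, comm_zpow_right h3, comm_zpow_left h2, h1, zpow_neg, ← inv_zpow, zpow_mul]

/-- Normal form by induction on words: a new y₂ on the left is moved past y₁^i at the cost of a
central power of w. -/
theorem exists_eq_zpow (x : Heisenberg n) : ∃ i j l : ℤ, x = y₁ ^ i * y₂ ^ j * w ^ l := by
  have hx : x ∈ Subgroup.closure {(y₁ : Heisenberg n), y₂} := by
    rw [closure_y₁_y₂]; exact Subgroup.mem_top x
  have hy₂ (e i j l : ℤ) : (y₂ : Heisenberg n) ^ e * (y₁ ^ i * y₂ ^ j * w ^ l) =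
      y₁ ^ i * y₂ ^ (e + j) * w ^ (-(e * i) + l) := by
    have hw : (w : Heisenberg n) ^ (-(e * i)) * y₂ ^ j = y₂ ^ j * w ^ (-(e * i)) :=
      (commute_y₂_w.zpow_zpow j _).eq.symm
    rw [zpow_add, zpow_add, ← mul_assoc, ← mul_assoc, y₂_zpow_mul_y₁_zpow]
    simp only [mul_assoc]
    rw [← mul_assoc (w ^ _), hw]
    simp only [mul_assoc]
  induction hx using Subgroup.closure_induction_left with
  | one => exact ⟨0, 0, 0, by simp⟩
  | mul_left x hx y hy ih =>
    obtain ⟨i, j, l, rfl⟩ := ih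
    obtain rfl | rfl := hx
    · exact ⟨1 + i, j, l, by simp [zpow_add, mul_assoc]⟩
    · exact ⟨i, 1 + j, -(1 * i) + l, by simpa using hy₂ 1 i j l⟩
  | inv_mul_cancel x hx y hy ih =>
    obtain ⟨i, j, l, rfl⟩ := ih
    obtain rfl | rfl := hx
    · exact ⟨-1 + i, j, l, by simp [zpow_add, mul_assoc]⟩
    · exact ⟨i, -1 + j, -(-1 * i) + l, by simpa using hy₂ (-1) i j l⟩

/-- The coordinates on the Heisenberg group. -/
theorem exists_model_hom (n : ℕ) : ∃ f : Heisenberg n →* HeisenbergModel (ZMod n),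
    Function.Injective f ∧ f y₁ = ⟨1, 0, 0⟩ ∧ f y₂ = ⟨0, 1, 0⟩ ∧ f w = ⟨0, 0, 1⟩ := by
  obtain ⟨f, h1, h2, h3⟩ := exists_lift (n := n)
    (⟨1, 0, 0⟩ : HeisenbergModel (ZMod n)) ⟨0, 1, 0⟩ ⟨0, 0, 1⟩ HeisenbergModel.comm_y₁_y₂
    (by rw [HeisenbergModel.mk_pow _ _ _ (by simp)]; ext <;> simp)
    (by rw [HeisenbergModel.mk_pow _ _ _ (by simp)]; ext <;> simp)
    (by rw [HeisenbergModel.mk_pow _ _ _ (by simp)]; ext <;> simp)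
    (comm_eq_one_iff.1 HeisenbergModel.comm_y₁_w) (comm_eq_one_iff.1 HeisenbergModel.comm_y₂_w)
  refine ⟨f, (injective_iff_map_eq_one f).2 fun x hx => ?_, h1, h2, h3⟩
  -- The coordinates of a normal form read off its exponents modulo n, and the generators have n-th
  -- power 1.
  obtain ⟨i, j, l, rfl⟩ := exists_eq_zpow x
  rw [map_mul, map_mul, map_zpow, map_zpow, map_zpow, h1, h2, h3,
    HeisenbergModel.mk_zpow _ _ _ (by simp), HeisenbergModel.mk_zpow _ _ _ (by simp),
    HeisenbergModel.mk_zpow _ _ _ (by simp)] at hx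
  have hi : (i : ZMod n) = 0 := by simpa using congrArg HeisenbergModel.a hx
  have hj : (j : ZMod n) = 0 := by simpa using congrArg HeisenbergModel.b hx
  have hl : (l : ZMod n) = 0 := by simpa [hi] using congrArg HeisenbergModel.c hx
  rw [ZMod.intCast_zmod_eq_zero_iff_dvd] at hi hj hl
  obtain ⟨i, rfl⟩ := hi
  obtain ⟨j, rfl⟩ := hj
  obtain ⟨l, rfl⟩ := hl
  simp [zpow_mul, y₁_pow, y₂_pow, w_pow]

instance [NeZero n] : Finite (Heisenberg n) :=
  let ⟨_, hf, _⟩ := exists_model_hom n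
  Finite.of_injective _ hf

theorem w_zpow_eq_one {i : ℤ} : (w : Heisenberg n) ^ i = 1 ↔ (n : ℤ) ∣ i := by
  obtain ⟨f, hf, -, -, hw⟩ := exists_model_hom n
  rw [← hf.eq_iff, map_zpow, map_one, hw, HeisenbergModel.mk_zpow _ _ _ (by simp),
    HeisenbergModel.ext_iff, ← ZMod.intCast_zmod_eq_zero_iff_dvd]
  simp

end Heisenberg

/-! ### The covering group and its kernel -/

namespace HeisenbergCover

variable {n : ℕ}

/-- The first generator of the covering group. -/
def y₁ : HeisenbergCover n := PresentedGroup.of .y₁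

/-- The second generator of the covering group. -/
def y₂ : HeisenbergCover n := PresentedGroup.of .y₂

/-- The generator of weight two of the covering group. -/
def w : HeisenbergCover n := PresentedGroup.of .w

/-- The first generator of weight three of the covering group. -/
def w₁ : HeisenbergCover n := PresentedGroup.of .w₁

/-- The second generator of weight three of the covering group. -/
def w₂ : HeisenbergCover n := PresentedGroup.of .w₂

theorem mk_eq_one {r : FreeGroup CGen} (hr : r ∈ heisenbergCoverRels n) :
    PresentedGroup.mk (heisenbergCoverRels n) r = 1 :=
  (QuotientGroup.eq_one_iff r).2 (Subgroup.subset_normalClosure hr)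

theorem comm_y₁_y₂ : comm (y₁ : HeisenbergCover n) y₂ = w := by
  have := mk_eq_one (n := n) (r := comm (.of .y₁) (.of .y₂) * (.of .w)⁻¹)
    (by simp [heisenbergCoverRels])
  rw [map_mul, map_inv, map_comm, mul_inv_eq_one] at this
  exact this

theorem comm_y₁_w : comm (y₁ : HeisenbergCover n) w = w₁ := by
  have := mk_eq_one (n := n) (r := comm (.of .y₁) (.of .w) * (.of .w₁)⁻¹)
    (by simp [heisenbergCoverRels])
  rw [map_mul, map_inv, map_comm, mul_inv_eq_one] at this
  exact this

theorem comm_y₂_w : comm (y₂ : HeisenbergCover n) w = w₂ := by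
  have := mk_eq_one (n := n) (r := comm (.of .y₂) (.of .w) * (.of .w₂)⁻¹)
    (by simp [heisenbergCoverRels])
  rw [map_mul, map_inv, map_comm, mul_inv_eq_one] at this
  exact this

theorem of_pow (x : CGen) : (PresentedGroup.of x : HeisenbergCover n) ^ n = 1 := by
  have := mk_eq_one (n := n) (r := FreeGroup.of x ^ n) (by cases x <;> simp [heisenbergCoverRels])
  rwa [map_pow] at this

theorem w₁_pow : (w₁ : HeisenbergCover n) ^ n = 1 := of_pow _

theorem w₂_pow : (w₂ : HeisenbergCover n) ^ n = 1 := of_pow _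

theorem lowerCentralSeries_three : (⊤ : Subgroup (HeisenbergCover n)).lowerCentralSeries 3 = ⊥ := by
  have h := Subgroup.map_lowerCentralSeries ⊤ (PresentedGroup.mk (heisenbergCoverRels n)) 3
  rw [Subgroup.map_top_of_surjective _ (PresentedGroup.mk_surjective _)] at h
  rw [← h, Subgroup.map_eq_bot_iff]
  exact fun r hr => mk_eq_one (.inr hr)

/-- The universal property of the covering group. -/
theorem exists_lift {G : Type*} [Group G] (a b c u v : G) (hc : comm a b = c)
    (hu : comm a c = u) (hv : comm b c = v) (ha : a ^ n = 1)
    (hb : b ^ n = 1) (hcn : c ^ n = 1) (hun : u ^ n = 1) (hvn : v ^ n = 1)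
    (hG : (⊤ : Subgroup G).lowerCentralSeries 3 = ⊥) :
    ∃ f : HeisenbergCover n →* G, f y₁ = a ∧ f y₂ = b ∧ f w = c ∧ f w₁ = u ∧ f w₂ = v := by
  let g : CGen → G := fun
    | .y₁ => a
    | .y₂ => b
    | .w => c
    | .w₁ => u
    | .w₂ => v
  have hg : ∀ r ∈ heisenbergCoverRels n, FreeGroup.lift g r = 1 := by
    rintro r ((rfl | rfl | rfl | rfl | rfl | rfl | rfl | rfl) | hr)
    · simp [map_comm, g, hc]
    · simp [map_comm, g, hu]
    · simp [map_comm, g, hv]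
    · simp [g, ha]
    · simp [g, hb]
    · simp [g, hcn]
    · simp [g, hun]
    · simp [g, hvn]
    -- The γ₄ relations die because the image of γ₄ of the free group lies in γ₄ of G.
    · have h1 : (Subgroup.map (FreeGroup.lift g) ⊤).lowerCentralSeries 3 ≤
          (⊤ : Subgroup G).lowerCentralSeries 3 := Subgroup.lowerCentralSeries_mono 3 le_top
      rw [hG, ← Subgroup.map_lowerCentralSeries] at h1
      exact h1 (Subgroup.mem_map_of_mem _ hr)
  exact ⟨PresentedGroup.toGroup hg, PresentedGroup.toGroup.of hg, PresentedGroup.toGroup.of hg,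
    PresentedGroup.toGroup.of hg, PresentedGroup.toGroup.of hg, PresentedGroup.toGroup.of hg⟩

/-- The coordinates on the covering group separate the elements of weight three. -/
theorem exists_model_hom (hn : Odd n) : ∃ (_ : Invertible (2 : ZMod n))
    (f : HeisenbergCover n →* CoverModel (ZMod n)),
      f w₁ = ⟨0, 0, 0, 1, 0⟩ ∧ f w₂ = ⟨0, 0, 0, 0, -1⟩ := by
  -- Every use of oddness in the proof traces back to this unit.
  have h2 : IsUnit ((2 : ℕ) : ZMod n) := (ZMod.isUnit_iff_coprime 2 n).2 hn.coprime_two_left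
  let : Invertible (2 : ZMod n) := (by simpa using h2 : IsUnit (2 : ZMod n)).invertible
  obtain ⟨f, -, -, -, h⟩ := exists_lift (n := n) (G := CoverModel (ZMod n)) _ _ _ _ _
    CoverModel.comm_y₁_y₂ CoverModel.comm_y₁_w CoverModel.comm_y₂_w
    (by rw [CoverModel.y₁_pow]; ext <;> simp) (by rw [CoverModel.y₂_pow]; ext <;> simp)
    (by rw [CoverModel.mk_pow]; ext <;> simp) (by rw [CoverModel.mk_pow]; ext <;> simp)
    (by rw [CoverModel.mk_pow]; ext <;> simp) CoverModel.lowerCentralSeries_three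
  exact ⟨inferInstance, f, h⟩

theorem w₁_zpow_mul_w₂_zpow_eq_one (hn : Odd n) {i j : ℤ}
    (h : (w₁ : HeisenbergCover n) ^ i * w₂ ^ j = 1) : (i : ZMod n) = 0 ∧ (j : ZMod n) = 0 := by
  obtain ⟨_, f, h1, h2⟩ := exists_model_hom hn
  have := congrArg f h
  rw [map_mul, map_zpow, map_zpow, map_one, h1, h2, CoverModel.mk_zpow, CoverModel.mk_zpow,
    CoverModel.ext_iff] at this
  simpa using this

theorem w₁_mem : (w₁ : HeisenbergCover n) ∈ (⊤ : Subgroup _).lowerCentralSeries 2 := by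
  rw [← comm_y₁_w, ← comm_y₁_y₂]
  exact comm_mem_lowerCentralSeries (comm_mem_lowerCentralSeries (i := 0) (Subgroup.mem_top _))

theorem w₂_mem : (w₂ : HeisenbergCover n) ∈ (⊤ : Subgroup _).lowerCentralSeries 2 := by
  rw [← comm_y₂_w, ← comm_y₁_y₂]
  exact comm_mem_lowerCentralSeries (comm_mem_lowerCentralSeries (i := 0) (Subgroup.mem_top _))

theorem nilpotencyClass_eq_three (hn : Odd n) (h1 : 1 < n) :
    Group.nilpotencyClass (HeisenbergCover n) = 3 := by
  have : Group.IsNilpotent (HeisenbergCover n) :=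
    Subgroup.nilpotent_iff_lowerCentralSeries.2 ⟨3, lowerCentralSeries_three⟩
  apply le_antisymm
  · exact Subgroup.lowerCentralSeries_eq_bot_iff_nilpotencyClass_le.1 lowerCentralSeries_three
  · by_contra! h
    have h2 := Subgroup.lowerCentralSeries_eq_bot_iff_nilpotencyClass_le.2 (Nat.le_of_lt_succ h)
    have h3 : (w₁ : HeisenbergCover n) = 1 := by
      have := w₁_mem (n := n)
      rwa [h2] at this
    have := (w₁_zpow_mul_w₂_zpow_eq_one hn (i := 1) (j := 0) (by simp [h3])).1
    have : Fact (1 < n) := ⟨h1⟩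
    simp at *

theorem lowerCentralSeries_two_le_center :
    (⊤ : Subgroup (HeisenbergCover n)).lowerCentralSeries 2 ≤ Subgroup.center _ := by
  have := lowerCentralSeries_three (n := n)
  rwa [Subgroup.lowerCentralSeries_succ, Subgroup.commutator_eq_bot_iff_le_centralizer,
    Subgroup.coe_top, Subgroup.centralizer_univ] at this

/-- The projection of the covering group to the Heisenberg group is a stem extension with kernel
`⟨w₁, w₂⟩`. -/
theorem exists_stem (n : ℕ) : ∃ π : HeisenbergCover n →* Heisenberg n,
    π y₁ = Heisenberg.y₁ ∧ π y₂ = Heisenberg.y₂ ∧ π w = Heisenberg.w ∧ IsStemExtension π ∧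
      π.ker = Subgroup.closure {w₁, w₂} := by
  obtain ⟨π, h1, h2, h3, h4, h5⟩ := exists_lift (n := n) (G := Heisenberg n) _ _ _ 1 1
    Heisenberg.comm_y₁_y₂ (comm_eq_one_iff.2 Heisenberg.commute_y₁_w)
    (comm_eq_one_iff.2 Heisenberg.commute_y₂_w) Heisenberg.y₁_pow Heisenberg.y₂_pow
    Heisenberg.w_pow (one_pow _) (one_pow _)
    (eq_bot_iff.2 ((Subgroup.lowerCentralSeries_antitone _ (by norm_num)).trans
      Heisenberg.lowerCentralSeries_two.le))
  let N : Subgroup (HeisenbergCover n) := Subgroup.closure {w₁, w₂}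
  have hw₁ : w₁ ∈ N := Subgroup.subset_closure (by simp)
  have hw₂ : w₂ ∈ N := Subgroup.subset_closure (by simp)
  have hN2 : N ≤ (⊤ : Subgroup _).lowerCentralSeries 2 := by
    rw [Subgroup.closure_le]
    rintro _ (rfl | rfl)
    exacts [w₁_mem, w₂_mem]
  have hNc := hN2.trans lowerCentralSeries_two_le_center
  have : N.Normal := normal_of_le_center hNc
  let q := QuotientGroup.mk' N
  have hq : ∀ x ∈ N, q x = 1 := fun x hx => (QuotientGroup.eq_one_iff x).2 hx
  -- Killing w₁ and w₂ yields the Heisenberg relations, so the quotient map by N factors through π;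
  -- this bounds the kernel of π by N.
  obtain ⟨σ, s1, s2, s3⟩ := Heisenberg.exists_lift (n := n) (q y₁) (q y₂) (q w)
    (by rw [← map_comm, comm_y₁_y₂])
    (by rw [← map_pow, y₁, of_pow, map_one]) (by rw [← map_pow, y₂, of_pow, map_one])
    (by rw [← map_pow, w, of_pow, map_one])
    (by rw [← comm_eq_one_iff, ← map_comm, comm_y₁_w, hq _ hw₁])
    (by rw [← comm_eq_one_iff, ← map_comm, comm_y₂_w, hq _ hw₂])
  have hσ : σ.comp π = q := by
    apply PresentedGroup.ext
    rintro (_ | _ | _ | _ | _)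
    · exact (congrArg σ h1).trans s1
    · exact (congrArg σ h2).trans s2
    · exact (congrArg σ h3).trans s3
    · exact (congrArg σ h4).trans ((map_one σ).trans (hq _ hw₁).symm)
    · exact (congrArg σ h5).trans ((map_one σ).trans (hq _ hw₂).symm)
  have hker : π.ker = N := by
    apply le_antisymm
    · intro x hx
      rw [← QuotientGroup.eq_one_iff]
      change q x = 1
      rw [← hσ, MonoidHom.comp_apply, MonoidHom.mem_ker.1 hx, map_one]
    · rw [Subgroup.closure_le]
      rintro _ (rfl | rfl)
      exacts [h4, h5]
  refine ⟨π, h1, h2, h3, ⟨?_, ?_, ?_⟩, hker⟩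
  · rw [← MonoidHom.range_eq_top, eq_top_iff, ← Heisenberg.closure_y₁_y₂, Subgroup.closure_le]
    rintro _ (rfl | rfl)
    exacts [⟨_, h1⟩, ⟨_, h2⟩]
  · rw [hker]; exact hNc
  · rw [hker, ← Subgroup.top_lowerCentralSeries_one]
    exact hN2.trans (Subgroup.lowerCentralSeries_antitone _ (by norm_num))

theorem commute_w₁_w₂ : Commute (w₁ : HeisenbergCover n) w₂ :=
  Subgroup.mem_center_iff.1 (lowerCentralSeries_two_le_center w₂_mem) w₁

theorem injective_zmodPairHom (hn : Odd n) : Function.Injective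
    (zmodPairHom (w₁ : HeisenbergCover n) w₂ w₁_pow w₂_pow commute_w₁_w₂) := by
  rw [injective_iff_map_eq_one]
  rintro ⟨x, y⟩ h
  obtain ⟨i, hi⟩ := ZMod.intCast_surjective x.toAdd
  obtain ⟨j, hj⟩ := ZMod.intCast_surjective y.toAdd
  rw [← ofAdd_toAdd x, ← ofAdd_toAdd y, ← hi, ← hj, zmodPairHom_intCast] at h
  obtain ⟨h1, h2⟩ := w₁_zpow_mul_w₂_zpow_eq_one hn h
  rw [← ofAdd_toAdd x, ← ofAdd_toAdd y, ← hi, ← hj, h1, h2]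
  rfl

/-- The subgroup `⟨w₁, w₂⟩` of the covering group is `ℤ/n × ℤ/n`. -/
theorem nonempty_closure_mulEquiv (hn : Odd n) :
    Nonempty (Subgroup.closure {(w₁ : HeisenbergCover n), w₂} ≃*
      Multiplicative (ZMod n) × Multiplicative (ZMod n)) :=
  ⟨((MonoidHom.ofInjective (injective_zmodPairHom hn)).trans
    (MulEquiv.subgroupCongr (range_zmodPairHom _ _ _))).symm⟩

end HeisenbergCover

/-! ### Stem extensions of the Heisenberg group -/

namespace IsStemExtension

variable {n : ℕ} {E : Type*} [Group E] {π : E →* Heisenberg n} {a b : E}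

theorem comm_mem_ker (ha : π a = Heisenberg.y₁) (hb : π b = Heisenberg.y₂) :
    comm a (comm a b) ∈ π.ker ∧ comm b (comm a b) ∈ π.ker := by
  simp only [MonoidHom.mem_ker, map_comm, ha, hb, Heisenberg.comm_y₁_y₂]
  exact ⟨comm_eq_one_iff.2 Heisenberg.commute_y₁_w, comm_eq_one_iff.2 Heisenberg.commute_y₂_w⟩

/-- A central power of `g` kills the central commutators of `g`. -/
theorem comm_pow_eq_one (hπ : IsStemExtension π) {g h : E} (hg : π g ^ n = 1)
    (hc : comm g h ∈ π.ker) : comm g h ^ n = 1 := by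
  have h1 : g ^ n ∈ Subgroup.center E := hπ.ker_le_center (by rwa [MonoidHom.mem_ker, map_pow])
  have h2 := comm_zpow_left (hπ.ker_le_center hc) n
  rw [zpow_natCast, zpow_natCast] at h2
  rw [← h2, comm_eq_one_iff]
  exact (Subgroup.mem_center_iff.1 h1 h).symm

/-- The kernel of a stem extension of the Heisenberg group is generated by the commutators of
weight three in lifts of the generators. -/
theorem ker_eq_closure (hπ : IsStemExtension π) (ha : π a = Heisenberg.y₁)
    (hb : π b = Heisenberg.y₂) :
    π.ker = Subgroup.closure {comm a (comm a b), comm b (comm a b)} := by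
  obtain ⟨hu, hv⟩ := comm_mem_ker ha hb
  set c := comm a b with hc
  set N := Subgroup.closure {comm a c, comm b c} with hN
  have hNle : N ≤ π.ker := by
    rw [Subgroup.closure_le]
    rintro _ (rfl | rfl)
    exacts [hu, hv]
  have hNn : N.Normal := normal_of_le_center (hNle.trans hπ.ker_le_center)
  let q := QuotientGroup.mk' N
  have hq : ∀ x, q x = 1 ↔ x ∈ N := fun x => QuotientGroup.eq_one_iff x
  have hqa : Commute (q a) (q c) := by
    rw [← comm_eq_one_iff, ← map_comm, hq]
    exact Subgroup.subset_closure (by simp)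
  have hqb : Commute (q b) (q c) := by
    rw [← comm_eq_one_iff, ← map_comm, hq]
    exact Subgroup.subset_closure (by simp)
  have hqs : Function.Surjective q := QuotientGroup.mk'_surjective N
  have hgen : Subgroup.closure ({a, b} ∪ (π.ker : Set E)) = ⊤ :=
    closure_lifts_union_ker π (by rw [Set.image_pair, ha, hb, Heisenberg.closure_y₁_y₂])
  have hker : ∀ m ∈ π.ker, ∀ x, Commute m x := fun m hm x =>
    (Subgroup.mem_center_iff.1 (hπ.ker_le_center hm) x).symm
  -- Modulo N, c commutes with a, b and the central kernel, and these generate E.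
  have hqc : q c ∈ Subgroup.center (E ⧸ N) := by
    have : Subgroup.closure ({a, b} ∪ (π.ker : Set E)) ≤
        (Subgroup.centralizer {q c}).comap q := by
      rw [Subgroup.closure_le]
      rintro x ((rfl | rfl) | hx) <;>
        refine Subgroup.mem_centralizer_singleton_iff.2 ?_
      · exact hqa
      · exact hqb
      · exact (hker x hx c).map q
    rw [hgen] at this
    refine Subgroup.mem_center_iff.2 fun y => ?_
    obtain ⟨x, rfl⟩ := hqs y
    exact Subgroup.mem_centralizer_singleton_iff.1 (this (Subgroup.mem_top x))
  have hDn : ((Subgroup.zpowers (q c)).comap q).Normal :=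
    (normal_of_le_center (Subgroup.zpowers_le.2 hqc)).comap q
  have hcomm : commutator E ≤ (Subgroup.zpowers (q c)).comap q := by
    refine commutator_le_of_closure_eq_top hgen ?_
    have h1 : ∀ x y, Commute x y → comm x y ∈ (Subgroup.zpowers (q c)).comap q :=
      fun x y h => by rw [comm_eq_one_iff.2 h]; exact one_mem _
    have h2 : c ∈ (Subgroup.zpowers (q c)).comap q := Subgroup.mem_zpowers (q c)
    rintro x ((rfl | rfl) | hx) y ((rfl | rfl) | hy)
    · exact h1 _ _ (Commute.refl _)
    · exact h2
    · exact h1 _ _ (hker y hy _).symm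
    · rw [← comm_inv]; exact inv_mem h2
    · exact h1 _ _ (Commute.refl _)
    · exact h1 _ _ (hker y hy _).symm
    · exact h1 _ _ (hker x hx _)
    · exact h1 _ _ (hker x hx _)
    · exact h1 _ _ (hker x hx _)
  -- Since a^n lies in the central kernel, [a, b]^n = [a^n, b] = 1 modulo N.
  have hcn : q c ^ n = 1 := by
    have h1 : a ^ n ∈ π.ker := by rw [MonoidHom.mem_ker, map_pow, ha, Heisenberg.y₁_pow]
    have h2 : comm (q a ^ (n : ℤ)) (q b) = 1 := by
      rw [zpow_natCast, ← map_pow, comm_eq_one_iff]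
      exact (hker _ h1 b).map q
    have h3 : comm (q a) (q b) = q c := by rw [← map_comm, hc]
    rwa [comm_zpow_left (by rwa [h3]), h3, zpow_natCast] at h2
  refine le_antisymm (fun m hm => ?_) hNle
  -- The stem condition makes m a power c^i modulo N. Projecting to H gives w^i = 1, so n divides i
  -- and c^i vanishes modulo N.
  obtain ⟨i, hi⟩ := hcomm (hπ.ker_le_commutator hm)
  have hi : q c ^ i = q m := hi
  have h1 : (c ^ i)⁻¹ * m ∈ N := by
    rw [← hq, map_mul, map_inv, map_zpow, hi, inv_mul_cancel]
  have h2 : π (c ^ i) = 1 := by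
    have := hNle h1
    rw [MonoidHom.mem_ker, map_mul, map_inv, MonoidHom.mem_ker.1 hm, mul_one, inv_eq_one] at this
    exact this
  rw [map_zpow, hc, map_comm, ha, hb, Heisenberg.comm_y₁_y₂, Heisenberg.w_zpow_eq_one] at h2
  obtain ⟨j, rfl⟩ := h2
  rw [← hq, ← hi, zpow_mul, zpow_natCast, hcn, one_zpow]

/-- The parametrization of the kernel of a stem extension of the Heisenberg group. -/
theorem exists_zmodPairHom (hπ : IsStemExtension π) (ha : π a = Heisenberg.y₁)
    (hb : π b = Heisenberg.y₂) :
    ∃ φ : Multiplicative (ZMod n) × Multiplicative (ZMod n) →* E, φ.range = π.ker ∧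
      ∀ i j : ℤ, φ (.ofAdd (i : ZMod n), .ofAdd (j : ZMod n)) =
        comm a (comm a b) ^ i * comm b (comm a b) ^ j := by
  obtain ⟨hu, hv⟩ := comm_mem_ker ha hb
  have huv : Commute (comm a (comm a b)) (comm b (comm a b)) :=
    Subgroup.mem_center_iff.1 (hπ.ker_le_center hv) _
  refine ⟨zmodPairHom _ _ (hπ.comm_pow_eq_one (by rw [ha, Heisenberg.y₁_pow]) hu)
    (hπ.comm_pow_eq_one (by rw [hb, Heisenberg.y₂_pow]) hv) huv, ?_, zmodPairHom_intCast _ _ _⟩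
  rw [range_zmodPairHom, hπ.ker_eq_closure ha hb]

theorem card_eq {E G : Type*} [Group E] [Group G] {π : E →* G} (hπ : IsStemExtension π) :
    Nat.card E = Nat.card G * Nat.card π.ker := by
  rw [Subgroup.card_eq_card_quotient_mul_card_subgroup π.ker,
    Nat.card_congr (QuotientGroup.quotientKerEquivOfSurjective π hπ.surjective).toEquiv]

theorem card_ker_le [NeZero n] (hπ : IsStemExtension π) : Nat.card π.ker ≤ n ^ 2 := by
  obtain ⟨a, ha⟩ := hπ.surjective Heisenberg.y₁
  obtain ⟨b, hb⟩ := hπ.surjective Heisenberg.y₂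
  obtain ⟨φ, hφ, -⟩ := hπ.exists_zmodPairHom ha hb
  rw [← hφ, ← card_zmod_pair]
  exact Nat.card_le_card_of_surjective _ φ.rangeRestrict_surjective

/-- Commutators with the lift of the central generator. -/
theorem comm_eq (hπ : IsStemExtension π) (ha : π a = Heisenberg.y₁) (hb : π b = Heisenberg.y₂)
    {e : E} {i j l : ℤ} (he : π e = Heisenberg.y₁ ^ i * Heisenberg.y₂ ^ j * Heisenberg.w ^ l)
    (s : ℤ) : comm e (comm a b ^ s) =
      comm a (comm a b) ^ (i * s) * comm b (comm a b) ^ (j * s) := by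
  obtain ⟨hu, hv⟩ := comm_mem_ker ha hb
  replace hu := hπ.ker_le_center hu
  replace hv := hπ.ker_le_center hv
  set c := comm a b with hc
  -- The element e agrees with a^i b^j c^l up to a central factor, which no commutator sees.
  have hm : (a ^ i * b ^ j * c ^ l)⁻¹ * e ∈ Subgroup.center E := by
    apply hπ.ker_le_center
    rw [MonoidHom.mem_ker, map_mul, he, map_inv, inv_mul_eq_one]
    simp only [map_mul, map_zpow, ha, hb, hc, map_comm, Heisenberg.comm_y₁_y₂]
  obtain ⟨m, rfl⟩ : ∃ m, e = a ^ i * b ^ j * c ^ l * m := ⟨_, (mul_inv_cancel_left _ e).symm⟩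
  rw [inv_mul_cancel_left] at hm
  have h1 : comm (a ^ i) c = comm a c ^ i := comm_zpow_left hu i
  have h2 : comm (b ^ j) c = comm b c ^ j := comm_zpow_left hv j
  have h3 : comm (c ^ l) c = 1 := comm_eq_one_iff.2 (Commute.zpow_self c l)
  have h4 : comm m c = 1 := comm_eq_one_iff.2 (Subgroup.mem_center_iff.1 hm c).symm
  have h5 : comm (a ^ i) c ∈ Subgroup.center E := h1 ▸ zpow_mem hu i
  have h6 : comm (b ^ j) c ∈ Subgroup.center E := h2 ▸ zpow_mem hv j
  have h7 : comm (a ^ i * b ^ j) c = comm a c ^ i * comm b c ^ j := by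
    rw [comm_mul_left h5, h1, h2]
  have h8 : comm (a ^ i * b ^ j) c ∈ Subgroup.center E := by
    rw [comm_mul_left h5]; exact mul_mem h5 h6
  have h9 : comm (a ^ i * b ^ j * c ^ l) c = comm a c ^ i * comm b c ^ j := by
    rw [comm_mul_left h8, h3, mul_one, h7]
  have h10 : comm (a ^ i * b ^ j * c ^ l * m) c = comm a c ^ i * comm b c ^ j := by
    rw [comm_mul_left (by rw [h9, ← h7]; exact h8), h4, mul_one, h9]
  rw [comm_zpow_right (by rw [h10, ← h7]; exact h8), h10, Commute.mul_zpow, zpow_mul, zpow_mul]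
  exact Subgroup.mem_center_iff.1 (zpow_mem hv j) _

/-- Over a cyclic subgroup, every element is a power of one fixed lift times a central element. -/
theorem commute_of_mem_zpowers {E G : Type*} [Group E] [Group G] {π : E →* G}
    (hπ : IsStemExtension π) {g : G} {e f : E} (he : π e ∈ Subgroup.zpowers g)
    (hf : π f ∈ Subgroup.zpowers g) : Commute e f := by
  obtain ⟨g, rfl⟩ := hπ.surjective g
  have key : ∀ x, π x ∈ Subgroup.zpowers (π g) → ∃ i : ℤ, ∃ m ∈ Subgroup.center E,
      x = g ^ i * m := by
    rintro x ⟨i, hi⟩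
    refine ⟨i, (g ^ i)⁻¹ * x, hπ.ker_le_center ?_, (mul_inv_cancel_left _ x).symm⟩
    have hi : π g ^ i = π x := hi
    rw [MonoidHom.mem_ker, map_mul, map_inv, map_zpow, hi, inv_mul_cancel]
  obtain ⟨i, m, hm, rfl⟩ := key e he
  obtain ⟨j, m', hm', rfl⟩ := key f hf
  refine Commute.mul_left ?_ (Subgroup.mem_center_iff.1 hm _).symm
  exact Commute.mul_right (Commute.zpow_zpow_self g i j) (Subgroup.mem_center_iff.1 hm' _)

end IsStemExtension

/-! ### Cyclic pairs and the kernel order of a Schur cover -/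

theorem isCyclic_closure_pair_iff {G : Type*} [Group G] {x y : G} :
    IsCyclic (Subgroup.closure {x, y}) ↔
      ∃ g, x ∈ Subgroup.zpowers g ∧ y ∈ Subgroup.zpowers g := by
  constructor
  · intro h
    obtain ⟨g, hg⟩ := (Subgroup.isCyclic_iff_exists_zpowers_eq_top _).1 h
    refine ⟨g, ?_, ?_⟩ <;> rw [hg] <;> exact Subgroup.subset_closure (by simp)
  · rintro ⟨g, hx, hy⟩
    have h : Subgroup.closure {x, y} ≤ Subgroup.zpowers g := by
      rw [Subgroup.closure_le]
      rintro _ (rfl | rfl)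
      exacts [hx, hy]
    exact Subgroup.isCyclic_of_le h

theorem enhancedPowerGraph_le_deepCommutingGraph {E G : Type*} [Group E] [Group G] {π : E →* G}
    (hπ : IsStemExtension π) : enhancedPowerGraph G ≤ deepCommutingGraph π := by
  rintro x y ⟨hne, hc⟩
  obtain ⟨g, hx, hy⟩ := isCyclic_closure_pair_iff.1 hc
  refine ⟨hne, ?_⟩
  rintro e f rfl rfl
  exact hπ.commute_of_mem_zpowers hx hy

/-- Maximality against the covering group gives at least n², and the two generators of the kernel
give at most n². -/
theorem IsSchurCover.card_ker {n : ℕ} [NeZero n] (hn : Odd n) {E : Type*} [Group E]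
    {π : E →* Heisenberg n} (hπ : IsSchurCover π) : Nat.card π.ker = n ^ 2 := by
  obtain ⟨ρ, -, -, -, hρ, hker⟩ := HeisenbergCover.exists_stem n
  obtain ⟨e⟩ := HeisenbergCover.nonempty_closure_mulEquiv hn
  have h := hπ.card_le _ ρ hρ
  rw [hρ.card_eq, hπ.stem.card_eq, hker, Nat.card_congr e.toEquiv, card_zmod_pair] at h
  exact le_antisymm hπ.stem.card_ker_le (Nat.le_of_mul_le_mul_left h Nat.card_pos)

theorem isSchurCover_of_card_ker {n : ℕ} [NeZero n] {E : Type*} [Group E]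
    {π : E →* Heisenberg n} (hπ : IsStemExtension π) (h : Nat.card π.ker = n ^ 2) :
    IsSchurCover π where
  stem := hπ
  card_le F _ ρ hρ := by
    rw [hρ.card_eq, hπ.card_eq, h]
    exact Nat.mul_le_mul_left _ hρ.card_ker_le

/-! ### Schur covers, and the case of prime level -/

namespace IsSchurCover

variable {n : ℕ} {E : Type*} [Group E] {π : E →* Heisenberg n} {a b : E}

/-- A surjection from (ℤ/n)² onto a kernel of order n² is injective, so the two weight-three
commutators are independent. -/
theorem zpow_mul_zpow_eq_one [NeZero n] (hn : Odd n) (hπ : IsSchurCover π)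
    (ha : π a = Heisenberg.y₁) (hb : π b = Heisenberg.y₂) {i j : ℤ}
    (h : comm a (comm a b) ^ i * comm b (comm a b) ^ j = 1) :
    (i : ZMod n) = 0 ∧ (j : ZMod n) = 0 := by
  obtain ⟨φ, hφ, hφ'⟩ := hπ.stem.exists_zmodPairHom ha hb
  have hcard := hπ.card_ker hn
  rw [← hφ, ← card_zmod_pair] at hcard
  have : Finite (Multiplicative (ZMod n)) := Finite.of_equiv (ZMod n) Multiplicative.ofAdd
  have hinj : Function.Injective φ.rangeRestrict :=
    ((Nat.bijective_iff_surjective_and_card _).2 ⟨φ.rangeRestrict_surjective, hcard.symm⟩).1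
  rw [MonoidHom.rangeRestrict_injective_iff, injective_iff_map_eq_one] at hinj
  have := hinj _ ((hφ' i j).trans h)
  exact ⟨congrArg (fun x => x.1.toAdd) this, congrArg (fun x => x.2.toAdd) this⟩

/-- In a Schur cover of the Heisenberg group over a prime field, the lifts of `x` and `y` with `x`
not central commute only if `y` is a power of `x`. -/
theorem mem_zpowers_of_commute {p : ℕ} [Fact p.Prime] (hp : Odd p) {π : E →* Heisenberg p}
    (hπ : IsSchurCover π) {f : Heisenberg p →* HeisenbergModel (ZMod p)}
    (hf : Function.Injective f) (h1 : f Heisenberg.y₁ = ⟨1, 0, 0⟩)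
    (h2 : f Heisenberg.y₂ = ⟨0, 1, 0⟩) (h3 : f Heisenberg.w = ⟨0, 0, 1⟩) {x y : E}
    (hxy : Commute x y) (hx : (f (π x)).a ≠ 0 ∨ (f (π x)).b ≠ 0) :
    π y ∈ Subgroup.zpowers (π x) := by
  obtain ⟨a, ha⟩ := hπ.stem.surjective Heisenberg.y₁
  obtain ⟨b, hb⟩ := hπ.stem.surjective Heisenberg.y₂
  have hfxy := congrArg HeisenbergModel.c (((hxy.map π).map f).eq)
  simp only [HeisenbergModel.mul_c] at hfxy
  set X := f (π x) with hX
  set Y := f (π y) with hY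
  -- Commuting in H means a vanishing determinant; over the field ℤ/p this makes (Y.a, Y.b) a
  -- multiple of the nonzero vector (X.a, X.b).
  have hab : X.a * Y.b = Y.a * X.b := by linear_combination hfxy
  obtain ⟨t, hta, htb⟩ : ∃ t : ZMod p, Y.a = t * X.a ∧ Y.b = t * X.b := by
    rcases hx with hx | hx
    · refine ⟨Y.a / X.a, (div_mul_cancel₀ _ hx).symm, ?_⟩
      field_simp
      linear_combination hab
    · refine ⟨Y.b / X.b, ?_, (div_mul_cancel₀ _ hx).symm⟩
      field_simp
      linear_combination -hab
  obtain ⟨t, rfl⟩ := ZMod.intCast_surjective t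
  obtain ⟨s, hs⟩ := ZMod.intCast_surjective (f ((π x ^ t)⁻¹ * π y)).c
  have hz : (π x ^ t)⁻¹ * π y = Heisenberg.w ^ s := by
    apply hf
    rw [map_zpow, h3, HeisenbergModel.mk_zpow _ _ _ (by simp), hs]
    ext
    · simp [HeisenbergModel.zpow_a, ← hX, ← hY, hta]
    · simp [HeisenbergModel.zpow_b, ← hX, ← hY, htb]
    · simp
  -- Since x commutes with x^(-t) y, it commutes with c^s, which differs from that element by a
  -- central factor.
  have hcm : Commute x ((comm a b) ^ s) := by
    have hm : ((comm a b) ^ s)⁻¹ * ((x ^ t)⁻¹ * y) ∈ Subgroup.center E := by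
      apply hπ.stem.ker_le_center
      rw [MonoidHom.mem_ker, map_mul, map_mul, map_inv, map_inv, map_zpow, map_zpow, hz, map_comm,
        ha, hb, Heisenberg.comm_y₁_y₂, inv_mul_cancel]
    have h4 : Commute x ((x ^ t)⁻¹ * y) :=
      ((Commute.self_zpow x t).inv_right).mul_right hxy
    have h5 := h4.mul_right ((Subgroup.mem_center_iff.1 (inv_mem hm) x : Commute x _))
    rwa [mul_inv_rev _ (_ * y), inv_inv, mul_inv_cancel_left] at h5
  obtain ⟨i, j, l, hx'⟩ := Heisenberg.exists_eq_zpow (π x)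
  rw [← comm_eq_one_iff, hπ.stem.comm_eq ha hb hx'] at hcm
  obtain ⟨his, hjs⟩ := hπ.zpow_mul_zpow_eq_one hp ha hb hcm
  have hXa : X.a = i := by
    simp [hX, hx', h1, h2, h3, HeisenbergModel.zpow_a]
  have hXb : X.b = j := by
    simp [hX, hx', h1, h2, h3, HeisenbergModel.zpow_b]
  rw [Int.cast_mul, ← hXa] at his
  rw [Int.cast_mul, ← hXb] at hjs
  have hs0 : (s : ZMod p) = 0 := by
    rcases hx with hx | hx
    · exact (mul_eq_zero.1 his).resolve_left hx
    · exact (mul_eq_zero.1 hjs).resolve_left hx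
  rw [ZMod.intCast_zmod_eq_zero_iff_dvd] at hs0
  rw [Heisenberg.w_zpow_eq_one.2 hs0, inv_mul_eq_one] at hz
  exact ⟨t, hz⟩

theorem deepCommutingGraph_le {p : ℕ} [Fact p.Prime] (hp : Odd p) {π : E →* Heisenberg p}
    (hπ : IsSchurCover π) : deepCommutingGraph π ≤ enhancedPowerGraph (Heisenberg p) := by
  rintro x y ⟨hne, hc⟩
  refine ⟨hne, isCyclic_closure_pair_iff.2 ?_⟩
  obtain ⟨x, rfl⟩ := hπ.stem.surjective x
  obtain ⟨y, rfl⟩ := hπ.stem.surjective y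
  have hxy := hc x y rfl rfl
  obtain ⟨f, hf, h1, h2, h3⟩ := Heisenberg.exists_model_hom p
  by_cases hx : (f (π x)).a ≠ 0 ∨ (f (π x)).b ≠ 0
  · exact ⟨π x, Subgroup.mem_zpowers _, hπ.mem_zpowers_of_commute hp hf h1 h2 h3 hxy hx⟩
  by_cases hy : (f (π y)).a ≠ 0 ∨ (f (π y)).b ≠ 0
  · exact ⟨π y, hπ.mem_zpowers_of_commute hp hf h1 h2 h3 hxy.symm hy, Subgroup.mem_zpowers _⟩
  -- In the remaining case both images lie in the cyclic group ⟨w⟩.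
  have key : ∀ z, ¬((f z).a ≠ 0 ∨ (f z).b ≠ 0) → z ∈ Subgroup.zpowers Heisenberg.w := by
    intro z hz
    push Not at hz
    obtain ⟨s, hs⟩ := ZMod.intCast_surjective (f z).c
    refine ⟨s, hf ?_⟩
    change f (Heisenberg.w ^ s) = _
    rw [map_zpow, h3, HeisenbergModel.mk_zpow _ _ _ (by simp), hs]
    ext <;> simp [hz.1, hz.2]
  exact ⟨_, key _ hx, key _ hy⟩

end IsSchurCover

/-! ### Failure of equality at higher prime powers -/

/-- In a finite cyclic group, elements of the same order are powers of each other. -/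
theorem mem_zpowers_of_orderOf_eq {G : Type*} [Group G] [Finite G] {g x y : G}
    (hx : x ∈ Subgroup.zpowers g) (hy : y ∈ Subgroup.zpowers g) (h : orderOf x = orderOf y) :
    y ∈ Subgroup.zpowers x := by
  classical
  lift x to Subgroup.zpowers g using hx
  lift y to Subgroup.zpowers g using hy
  rw [Subgroup.orderOf_coe, Subgroup.orderOf_coe] at h
  have := Fintype.ofFinite (Subgroup.zpowers g)
  -- A cyclic group has at most m solutions of z^m = 1, and ⟨x⟩ already supplies m of them for m the
  -- order of x.
  have h1 : Finset.univ.filter (· ∈ Subgroup.zpowers x) =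
      Finset.univ.filter (fun z : Subgroup.zpowers g => z ^ orderOf x = 1) := by
    refine Finset.eq_of_subset_of_card_le (fun z hz => ?_) ?_
    · rw [Finset.mem_filter_univ] at hz ⊢
      exact orderOf_dvd_iff_pow_eq_one.1 (orderOf_dvd_of_mem_zpowers hz)
    · refine (IsCyclic.card_pow_eq_one_le (orderOf_pos x)).trans ?_
      rw [← Nat.card_zpowers, Nat.card_eq_fintype_card, Fintype.card_subtype]
  have h2 : y ∈ Finset.univ.filter (· ∈ Subgroup.zpowers x) := by
    rw [h1, Finset.mem_filter_univ, h, pow_orderOf_eq_one]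
  obtain ⟨t, ht⟩ := (Finset.mem_filter_univ _).1 h2
  exact ⟨t, congrArg Subtype.val ht⟩

theorem enhancedPowerGraph_ne_deepCommutingGraph {p k : ℕ} (hp : p.Prime) {E : Type*} [Group E]
    {π : E →* Heisenberg (p ^ (k + 2))} (hπ : IsStemExtension π) :
    enhancedPowerGraph (Heisenberg (p ^ (k + 2))) ≠ deepCommutingGraph π := by
  have hpk : ¬ p ^ (k + 2) ∣ p ^ (k + 1) := fun h =>
    absurd ((Nat.pow_dvd_pow_iff_le_right hp.one_lt).1 h) (by omega)
  have : NeZero (p ^ (k + 2)) := ⟨(pow_pos hp.pos _).ne'⟩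
  have : Fact p.Prime := ⟨hp⟩
  have hne0 : ((p ^ (k + 1) : ℕ) : ZMod (p ^ (k + 2))) ≠ 0 := by
    rwa [Ne, ZMod.natCast_eq_zero_iff]
  have hpp : p ^ (k + 1) * p = p ^ (k + 2) := by ring
  obtain ⟨f, hf, h1, h2, h3⟩ := Heisenberg.exists_model_hom (p ^ (k + 2))
  have hfy (m : ℕ) : f (Heisenberg.y₁ ^ m) = ⟨m, 0, 0⟩ := by
    rw [map_pow, h1, HeisenbergModel.mk_pow _ _ _ (by simp)]; simp
  have hfw (m : ℕ) : f (Heisenberg.w ^ m) = ⟨0, 0, m⟩ := by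
    rw [map_pow, h3, HeisenbergModel.mk_pow _ _ _ (by simp)]; simp
  have hord : orderOf (Heisenberg.y₁ ^ p ^ (k + 1) : Heisenberg (p ^ (k + 2))) = p := by
    refine orderOf_eq_prime (by rw [← pow_mul, hpp, Heisenberg.y₁_pow]) fun h => hne0 ?_
    have := congrArg HeisenbergModel.a ((hfy _).symm.trans ((congrArg f h).trans (map_one f)))
    exact this
  have hord' : orderOf (Heisenberg.w ^ p ^ (k + 1) : Heisenberg (p ^ (k + 2))) = p := by
    refine orderOf_eq_prime (by rw [← pow_mul, hpp, Heisenberg.w_pow]) fun h => hne0 ?_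
    have := congrArg HeisenbergModel.c ((hfw _).symm.trans ((congrArg f h).trans (map_one f)))
    exact this
  intro heq
  -- The lifts have commutator [a, c]^(p^(k+1) · p) = 1, whatever the size of the kernel.
  have hadj : (deepCommutingGraph π).Adj (Heisenberg.y₁ ^ p ^ (k + 1)) (Heisenberg.w ^ p) := by
    constructor
    · intro h
      have := congrArg HeisenbergModel.a ((hfy _).symm.trans ((congrArg f h).trans (hfw _)))
      exact hne0 this
    · intro e e' he he'
      obtain ⟨a, ha⟩ := hπ.surjective Heisenberg.y₁
      obtain ⟨b, hb⟩ := hπ.surjective Heisenberg.y₂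
      have hu : comm a (comm a b) ^ p ^ (k + 2) = 1 :=
        hπ.comm_pow_eq_one (by rw [ha, Heisenberg.y₁_pow]) (IsStemExtension.comm_mem_ker ha hb).1
      have hc : Commute e (comm a b ^ p) := by
        have := hπ.comm_eq ha hb (e := e) (i := (p ^ (k + 1) : ℕ)) (j := 0) (l := 0)
          (by rw [zpow_natCast, he]; simp) p
        rw [← comm_eq_one_iff, ← zpow_natCast (comm a b), this, ← Nat.cast_mul, hpp, zpow_natCast,
          hu]
        simp
      have hm : (comm a b ^ p)⁻¹ * e' ∈ Subgroup.center E := by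
        apply hπ.ker_le_center
        rw [MonoidHom.mem_ker, map_mul, he', map_inv, map_pow, map_comm, ha, hb,
          Heisenberg.comm_y₁_y₂, inv_mul_cancel]
      simpa using hc.mul_right (Subgroup.mem_center_iff.1 hm e)
  rw [← heq] at hadj
  obtain ⟨g, hx, hy⟩ := isCyclic_closure_pair_iff.1 hadj.2
  -- Raising w^p to the power p^k brings it to order p, where it must be a power of the other
  -- witness; the c coordinate forbids this.
  have hy' : (Heisenberg.w ^ p ^ (k + 1) : Heisenberg (p ^ (k + 2))) ∈ Subgroup.zpowers g := by
    have := pow_mem hy (p ^ k)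
    rwa [← pow_mul, ← pow_succ'] at this
  obtain ⟨t, ht⟩ := mem_zpowers_of_orderOf_eq hx hy' (hord.trans hord'.symm)
  have ht : (Heisenberg.y₁ ^ p ^ (k + 1)) ^ t = Heisenberg.w ^ p ^ (k + 1) := ht
  have := congrArg (fun z => (f z).c) ht
  simp only [map_zpow, hfy, hfw] at this
  rw [HeisenbergModel.mk_zpow _ _ _ (mul_zero _)] at this
  exact hne0 (by rw [← this, mul_zero])

end DeepCommuting

theorem mainTheorem9 (p k : ℕ) (hp : p.Prime) (hodd : Odd p) (hk : 1 ≤ k) :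
    (∃ π : HeisenbergCover (p ^ k) →* Heisenberg (p ^ k),
      π (PresentedGroup.of .y₁) = PresentedGroup.of .y₁ ∧
      π (PresentedGroup.of .y₂) = PresentedGroup.of .y₂ ∧
      π (PresentedGroup.of .w) = PresentedGroup.of .w ∧
      IsSchurCover π ∧
      Nonempty (π.ker ≃* Multiplicative (ZMod (p ^ k)) × Multiplicative (ZMod (p ^ k)))) ∧
    Group.nilpotencyClass (HeisenbergCover (p ^ k)) = 3 ∧
    (∀ (E : Type*) [Group E] (π : E →* Heisenberg (p ^ k)), IsSchurCover π →
      (enhancedPowerGraph (Heisenberg (p ^ k)) = deepCommutingGraph π ↔ k = 1)) := by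
  have hn : Odd (p ^ k) := hodd.pow
  have : NeZero (p ^ k) := ⟨(pow_pos hp.pos k).ne'⟩
  have : Fact p.Prime := ⟨hp⟩
  refine ⟨?_, HeisenbergCover.nilpotencyClass_eq_three hn (Nat.one_lt_pow (by omega) hp.one_lt),
    fun E _ π hπ => ⟨fun h => ?_, ?_⟩⟩
  · obtain ⟨π, h1, h2, h3, hπ, hker⟩ := HeisenbergCover.exists_stem (p ^ k)
    obtain ⟨e⟩ := HeisenbergCover.nonempty_closure_mulEquiv hn
    refine ⟨π, h1, h2, h3, isSchurCover_of_card_ker hπ ?_,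
      ⟨(MulEquiv.subgroupCongr hker).trans e⟩⟩
    rw [hker, Nat.card_congr e.toEquiv, card_zmod_pair]
  · by_contra hk1
    obtain ⟨k, rfl⟩ : ∃ m, k = m + 2 := ⟨k - 2, by omega⟩
    exact enhancedPowerGraph_ne_deepCommutingGraph hp hπ.stem h
  · rintro rfl
    refine le_antisymm (enhancedPowerGraph_le_deepCommutingGraph hπ.stem) ?_
    -- The type of π depends on p ^ 1, so the level is generalized before being identified with p.
    generalize hq : p ^ 1 = q at π
    obtain rfl : p = q := by rw [← hq, pow_one]
    exact hπ.deepCommutingGraph_le hodd
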